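/- **The MDP.** Let $\alpha,\beta\in[0,1]$. The source MDP $\mathcal M$ (without reward) has states $x_0,\dots,x_3,y_0,\dots,y_3$, actions $r,b$, initial distribution $p_0(x_0)=p_0(y_0)=1/2$ and the following transitions. From $x_0$, action $r$ leads to $x_1$ and $b$ leads to $y_1$; from $y_0$, action $r$ leads to $y_1$ and $b$ leads to $x_1$. From $x_1$, either action leads to $x_2$ with probability $\alpha$ and to $x_3$ with probability $1-\alpha$; from $y_1$, either action leads to $y_2$ with probability $\beta$ and to $y_3$ with probability $1-\beta$. The states $x_2,x_3,y_2,y_3$ are absorbing. The target MDP $\hat{\mathcal M}$ has states $\hat x_0,\dots,\hat x_3,\hat y_0,\dots,\hat y_3$ and is the pull-back of $\mathcal M$ along a bijection $\Pi_*$ from target to source states: $\hat P(t'\mid t,a)=P(\Pi_*t'\mid \Pi_*t,a)$ and $\hat p_0(t)=p_0(\Pi_*t)$. Here $\Pi_*\in\{\Pi_1,\Pi_2\}$, where $\Pi_1(\hat x_i)=x_i$, $\Pi_1(\hat y_i)=y_i$ and $\Pi_2(\hat x_i)=y_i$, $\Pi_2(\hat y_i)=x_i$. **The loss.** Let $\gamma\in(0,1)$.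 The occupancy measure of a stationary stochastic policy $\psi$ in an MDP is $\rho_\psi(s,a)=(1-\gamma)\sum_{n\ge0}\gamma^n\,\psi(a\mid s)\,\mathbb P(s_n=s)$. Let $\phi$ be any policy in $\mathcal M$ with $\phi(r\mid x_0)=1$ and $\phi(b\mid y_0)=1$. The imitation loss of a policy $\hat\phi$ in $\hat{\mathcal M}$ is $g(\phi,\Pi_*,\hat\phi)=\mathrm{TV}\big(\rho_\phi(\Pi_*\,\cdot\,,\cdot\,),\ \rho_{\hat\phi,\Pi_*}\big)$, where $\rho_{\hat\phi,\Pi_*}$ is the occupancy measure of $\hat\phi$ in $\hat{\mathcal M}$ and $\mathrm{TV}(p,q)=\frac12\sum|p-q|$. **Online algorithms.** The interaction starts in a state drawn from $\hat p_0$. In each round a randomized algorithm, on the basis of the complete history (its own earlier decisions, and the states and actions observed), either makes one transition of $\hat{\mathcal M}$ from the current state with a policy of its choice, and observes the action and the new state; or resets the current state to a new draw from $\hat p_0$, which it observes; or stops and outputs a policy $\hat\phi$. Let $T\in\{0,1,2,\dots\}\cup\{\infty\}$ be the number of transitions made before stopping (resets are not counted). The algorithm may depend on $\mathcal M,\phi,\gamma$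 and all parameters, but not on $\Pi_*$. **Theorem.** There are universal constants $\epsilon_0\in(0,1/2]$, $\delta_0\in(0,1]$ and $c>0$ such that the following holds for all $0<\epsilon<\epsilon_0$, $0<\delta<\delta_0$, $\gamma\in(0,1)$ and all $\phi$ as above. Let $\alpha=1/2+\epsilon$ and $\beta=1/2-\epsilon$. Consider any online algorithm that, for each $i\in\{1,2\}$, when $\Pi_*=\Pi_i$, stops and outputs a policy $\hat\phi$ with $g(\phi,\Pi_i,\hat\phi)\le\gamma/4$ with probability at least $1-\delta$. Then $$\mathbb E[T\mid\Pi_*=\Pi_i]\ \ge\ \frac{c}{\epsilon^2}\log\frac1\delta\qquad\text{for some } i\in\{1,2\}.$$ -/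

import Mathlib

open MeasureTheory ProbabilityTheory
open scoped ENNReal

namespace Imitation

noncomputable section

/-! ### Markov decision processes without reward, policies, occupancy measures -/

/-- A finite Markov decision process without reward: `P s a s'` is the probability of moving to
`s'` when action `a` is taken in state `s`, and `p0` is the initial distribution. -/
structure MDP (S A : Type*) [Fintype S] where
  P : S → A → stdSimplex ℝ S
  p0 : stdSimplex ℝ S

/-- A (stochastic) policy: `φ s a` is the probability of playing `a` in state `s`. -/
abbrev Policy (S A : Type*) [Fintype A] := S → stdSimplex ℝ A

section MDP

variable {S S' A : Type*} [Fintype S] [Fintype S'] [Fintype A]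

/-- The target MDP that corresponds to the source MDP `M` under the bijection `π : S' ≃ S`:
`P'(t' | t, a) = P(π t' | π t, a)` and `p0'(t) = p0(π t)`. -/
def MDP.target (M : MDP S A) (π : S' ≃ S) : MDP S' A where
  P t a := ⟨fun t' => (M.P (π t) a).1 (π t'),
    fun t' => (M.P (π t) a).2.1 (π t'), by
      rw [Equiv.sum_comp π (M.P (π t) a).1]; exact (M.P (π t) a).2.2⟩
  p0 := ⟨fun t => M.p0.1 (π t), fun t => M.p0.2.1 (π t), by
      rw [Equiv.sum_comp π M.p0.1]; exact M.p0.2.2⟩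

/-- The distribution of the state after `n` steps when `φ` is played from the initial
distribution. -/
def stateDist (M : MDP S A) (φ : Policy S A) : ℕ → S → ℝ
  | 0 => fun s => M.p0 s
  | n + 1 => fun s' => ∑ s, stateDist M φ n s * ∑ a, φ s a * M.P s a s'

/-- The normalized discounted state-action occupancy measure
`ρ_φ(s, a) = (1 - γ) ∑ₙ γⁿ φ(a | s) P(sₙ = s)`. -/
def occupancy (M : MDP S A) (γ : ℝ) (φ : Policy S A) (x : S × A) : ℝ :=
  (1 - γ) * ∑' n : ℕ, γ ^ n * (φ x.1 x.2 * stateDist M φ n x.1)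

/-- Total variation distance of two mass functions on a finite set. -/
def totalVariation {X : Type*} [Fintype X] (p q : X → ℝ) : ℝ :=
  (1 / 2) * ∑ x, |p x - q x|

/-- The imitation loss of the policy `ψ` played in the target domain: the total variation distance
between the occupancy measure of `φ` in the source domain, transported to the target domain along
`π`, and the occupancy measure of `ψ` in the target domain. -/
def imitationLoss (M : MDP S A) (γ : ℝ) (φ : Policy S A) (π : S' ≃ S) (ψ : Policy S' A) : ℝ :=
  totalVariation (fun x : S' × A => occupancy M γ φ (π x.1, x.2)) (occupancy (M.target π) γ ψ)

end MDP

/-! ### Online interaction with an MDP -/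

/-- What the agent may decide in a round, see `Decision.halt`, `Decision.play`,
`Decision.reset`. -/
abbrev Decision (S A : Type*) [Fintype A] := Policy S A ⊕ (Policy S A ⊕ Unit)

/-- Stop and output the policy `ψ`. -/
abbrev Decision.halt {S A : Type*} [Fintype A] (ψ : Policy S A) : Decision S A := Sum.inl ψ

/-- Make one transition from the current state with the policy `ψ`. -/
abbrev Decision.play {S A : Type*} [Fintype A] (ψ : Policy S A) : Decision S A :=
  Sum.inr (Sum.inl ψ)

/-- Replace the current state by a fresh draw from the initial distribution. -/
abbrev Decision.reset {S A : Type*} [Fintype A] : Decision S A := Sum.inr (Sum.inr ())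

/-- What is observed in a round: the action that was taken (`none` if there was none) and the
current state after the round. -/
abbrev Obs (S A : Type*) := Option A × S

/-- A round: the decision of the agent and what is then observed. -/
abbrev Round (S A : Type*) [Fintype A] := Decision S A × Obs S A

instance optionMeasurableSpace (A : Type*) : MeasurableSpace (Option A) := ⊤

instance optionDiscrete (A : Type*) : DiscreteMeasurableSpace (Option A) := ⟨fun _ => trivial⟩

section Online

variable {S A : Type*} [Fintype S] [Fintype A] [MeasurableSpace S] [DiscreteMeasurableSpace S]

/-- The law of what is observed, given the decision and the current state. -/
def MDP.obsLaw (M : MDP S A) : Decision S A × S → Measure (Obs S A)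
  | (Sum.inl _, s) => Measure.dirac (none, s)
  | (Sum.inr (Sum.inl ψ), s) => ∑ a, ∑ s',
      ENNReal.ofReal (ψ s a * M.P s a s') • Measure.dirac (some a, s')
  | (Sum.inr (Sum.inr _), _) => ∑ s', ENNReal.ofReal (M.p0 s') • Measure.dirac (none, s')

lemma MDP.measurable_obsLaw (M : MDP S A) : Measurable M.obsLaw := by
  refine Measure.measurable_of_measurable_coe _ fun B hB => ?_
  refine measurable_from_prod_countable_left fun s => ?_
  refine measurable_fun_sum ?_ (measurable_fun_sum ?_ ?_)
  · exact measurable_const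
  · have h : ∀ a, Measurable fun ψ : Policy S A => ψ s a := fun a =>
      (measurable_pi_apply a).comp (measurable_subtype_coe.comp (measurable_pi_apply s))
    simp only [Function.comp_def, MDP.obsLaw, Measure.finsetSum_apply, Measure.smul_apply,
      smul_eq_mul]
    exact Finset.measurable_sum _ fun a _ => Finset.measurable_sum _ fun s' _ =>
      ((h a).mul_const _).ennreal_ofReal.mul_const _
  · exact measurable_from_top

instance MDP.isProbabilityMeasure_obsLaw (M : MDP S A) (x : Decision S A × S) :
    IsProbabilityMeasure (M.obsLaw x) := by
  obtain ⟨d | ψ | u, s⟩ := x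
  · exact Measure.dirac.isProbabilityMeasure
  · constructor
    simp only [MDP.obsLaw, Measure.finsetSum_apply, Measure.smul_apply, smul_eq_mul, measure_univ,
      mul_one]
    have h : ∀ a s', 0 ≤ ψ s a * M.P s a s' := fun a s' =>
      mul_nonneg (stdSimplex.zero_le _ _) (stdSimplex.zero_le _ _)
    simp_rw [← ENNReal.ofReal_sum_of_nonneg (fun s' (_ : s' ∈ Finset.univ) => h _ s')]
    rw [← ENNReal.ofReal_sum_of_nonneg (fun a _ => Finset.sum_nonneg fun s' _ => h a s')]
    simp [← Finset.mul_sum]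
  · constructor
    simp only [MDP.obsLaw, Measure.finsetSum_apply, Measure.smul_apply, smul_eq_mul, measure_univ,
      mul_one]
    rw [← ENNReal.ofReal_sum_of_nonneg (fun s' _ => stdSimplex.zero_le _ _)]
    simp

/-- `MDP.obsLaw` as a Markov kernel. -/
def MDP.obsKernel (M : MDP S A) : Kernel (Decision S A × S) (Obs S A) where
  toFun := M.obsLaw
  measurable' := M.measurable_obsLaw

instance MDP.isMarkovKernel_obsKernel (M : MDP S A) : IsMarkovKernel M.obsKernel :=
  ⟨fun x => M.isProbabilityMeasure_obsLaw x⟩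

/-- A (randomized, adaptive) online algorithm: given the complete history of the rounds `0, …, n`,
it draws the decision of round `n + 1` from a distribution that depends measurably on the
history. -/
structure Algorithm (S A : Type*) [Fintype A] [MeasurableSpace S] where
  decide : (n : ℕ) → Kernel ((i : Finset.Iic n) → Round S A) (Decision S A)
  isMarkov : ∀ n, IsMarkovKernel (decide n)

/-- The law of round `n + 1` given the rounds `0, …, n`: the algorithm decides, and the observation
is then drawn according to this decision and the current state. -/
def roundKernel (M : MDP S A) (alg : Algorithm S A) (n : ℕ) :
    Kernel ((i : Finset.Iic n) → Round S A) (Round S A) :=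
  alg.decide n ⊗ₖ M.obsKernel.comap
    (fun x : ((i : Finset.Iic n) → Round S A) × Decision S A =>
      (x.2, (x.1 ⟨n, Finset.mem_Iic.2 le_rfl⟩).2.2)) (by fun_prop)

instance isMarkovKernel_roundKernel (M : MDP S A) (alg : Algorithm S A) (n : ℕ) :
    IsMarkovKernel (roundKernel M alg n) := by
  have := alg.isMarkov n
  unfold roundKernel
  infer_instance

/-- Round `0` is a reset: the interaction starts in a state drawn from the initial distribution. -/
def initialRound (M : MDP S A) : Measure (Round S A) :=
  ∑ s, ENNReal.ofReal (M.p0 s) • Measure.dirac (Decision.reset, (none, s))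

/-- The law of the infinite sequence of rounds when `alg` interacts with the MDP `M`. (It is
convenient to let the rounds go on after the algorithm has stopped; what happens then is
disregarded in `numTransitions` and in `Outputs`.) -/
def interactionLaw (M : MDP S A) (alg : Algorithm S A) : Measure (ℕ → Round S A) :=
  Kernel.trajMeasure (X := fun _ => Round S A) (initialRound M) (roundKernel M alg)

end Online

section Outcome

variable {S A : Type*} [Fintype A]

/-- The algorithm has not stopped before round `n`. -/
def NotStoppedBefore (ω : ℕ → Round S A) (n : ℕ) : Prop :=
  ∀ m < n, ∀ ψ, (ω m).1 ≠ Decision.halt ψ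

/-- The number `T` of transitions made before the algorithm stops. -/
def numTransitions (ω : ℕ → Round S A) : ℕ∞ :=
  Set.encard {n | NotStoppedBefore ω n ∧ ∃ ψ, (ω n).1 = Decision.play ψ}

/-- The algorithm stops and outputs the policy `ψ`. -/
def Outputs (ω : ℕ → Round S A) (ψ : Policy S A) : Prop :=
  ∃ n, NotStoppedBefore ω n ∧ (ω n).1 = Decision.halt ψ

end Outcome

/-! ### The bandit-like MDP -/

/-- The eight states. -/
inductive BState
  | x0 | x1 | x2 | x3 | y0 | y1 | y2 | y3
  deriving DecidableEq

instance : Fintype BState :=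
  ⟨{.x0, .x1, .x2, .x3, .y0, .y1, .y2, .y3}, fun s => by cases s <;> decide⟩

/-- The two actions, red and blue. -/
inductive BAction
  | r | b
  deriving DecidableEq

instance : Fintype BAction := ⟨{.r, .b}, fun a => by cases a <;> decide⟩

instance : MeasurableSpace BState := ⊤

instance : DiscreteMeasurableSpace BState := ⟨fun _ => trivial⟩

open BState BAction

/-- Transition probabilities of the bandit-like MDP. -/
def banditProb (α β : ℝ) : BState → BAction → BState → ℝ
  | x0, r, x1 => 1
  | x0, b, y1 => 1
  | y0, r, y1 => 1
  | y0, b, x1 => 1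
  | x1, _, x2 => α
  | x1, _, x3 => 1 - α
  | y1, _, y2 => β
  | y1, _, y3 => 1 - β
  | x2, _, x2 => 1
  | x3, _, x3 => 1
  | y2, _, y2 => 1
  | y3, _, y3 => 1
  | _, _, _ => 0

/-- Initial distribution of the bandit-like MDP. -/
def banditInit : BState → ℝ
  | x0 => 1 / 2
  | y0 => 1 / 2
  | _ => 0

lemma sum_bState (f : BState → ℝ) :
    ∑ s, f s = f x0 + f x1 + f x2 + f x3 + f y0 + f y1 + f y2 + f y3 := by
  have : (Finset.univ : Finset BState) = {x0, x1, x2, x3, y0, y1, y2, y3} := rfl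
  rw [this]
  simp [add_assoc]

/-- The bandit-like source MDP with parameters `α, β ∈ [0, 1]`. -/
def banditMDP (α β : unitInterval) : MDP BState BAction where
  P s a := ⟨banditProb α β s a, by
    intro s'
    have h1 := α.2.1
    have h2 := α.2.2
    have h3 := β.2.1
    have h4 := β.2.2
    cases s <;> cases a <;> cases s' <;> simp [banditProb, h1, h2, h3, h4], by
    rw [sum_bState]
    cases s <;> cases a <;> simp [banditProb]⟩
  p0 := ⟨banditInit, by
    intro s
    cases s <;> simp [banditInit], by
    rw [sum_bState]
    norm_num [banditInit]⟩

/-- Exchanges `xᵢ` and `yᵢ`. -/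
def swapXY : BState → BState
  | x0 => y0
  | x1 => y1
  | x2 => y2
  | x3 => y3
  | y0 => x0
  | y1 => x1
  | y2 => x2
  | y3 => x3

/-- The two possible bijections from the target states (which are named like the source states) to
the source states: the identity and the exchange of `xᵢ` and `yᵢ`. -/
def alignment : Fin 2 → (BState ≃ BState)
  | 0 => Equiv.refl BState
  | 1 => ⟨swapXY, swapXY, fun s => by cases s <;> rfl, fun s => by cases s <;> rfl⟩

end

end Imitation

set_option linter.unusedSectionVars false

/-! The theorem is a two-point testing bound. The two target MDPs share the initial distribution and
the first step; they differ only at `x1` and `y1`, where the success probabilities 1/2 + ε and 1/2 -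
ε are exchanged (`target_alignment_one`). The states `x1, x2, x3` form a closed class, as do `y1,
y2, y3`, and `probX ψ` is the mass that ψ sends into the first. A loss of at most γ/4 forces `probX
ψ ≥ 3/4` for the first alignment (`imitationLoss_zero_ge`) and `probX ψ ≤ 1/4` for the second
(`imitationLoss_one_ge`). Hence an accurate algorithm tests one MDP against the other with error δ.

Let ℓ be the log-likelihood ratio of the second MDP to the first along the observed run. The
algorithm's own randomness, resets and halts contribute nothing to it, and a transition lowers its
conditional mean by at most a Kullback-Leibler divergence, here at most κ = 16 ε²
(`sum_mul_log_banditRatio_ge`). Thus E ℓ ≥ -κ E T under the first MDP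
(`integral_stoppedLogLikelihood_ge`). Conversely, the event E that the output favours the first MDP
has probability at least 1/2 under the first and at most δ under the second. Since the latter is the
integral of exp ℓ over E under the first, ℓ must be about log δ on much of E, and E ℓ ≤ 3 - (1/2)
log(1/δ). Comparing the two bounds gives `ofReal_le_mul_lintegral_numTransitions`. All of this is
done up to a finite round N, so that no integrability is assumed of T. -/

namespace Imitation

/-! ### Change of measure between two MDPs for a fixed number of rounds. -/

section ChangeOfMeasure

open Preorder Finset

variable {S A : Type*} [Fintype S] [Fintype A] [MeasurableSpace S] [DiscreteMeasurableSpace S]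

/-- `g` is the ratio of the transition probabilities of `M₁` and `M₀`, which have the same initial
distribution. -/
structure IsTransitionRatio (M₀ M₁ : MDP S A) (g : S → S → ℝ) : Prop where
  pos : ∀ s s', 0 < g s s'
  self : ∀ s, g s s = 1
  init : ∀ s s', M₀.p0 s' ≠ 0 → g s s' = 1
  p0_eq : M₁.p0 = M₀.p0
  P_eq : ∀ s a s', M₁.P s a s' = M₀.P s a s' * g s s'

instance isProbabilityMeasure_initialRound (M : MDP S A) :
    IsProbabilityMeasure (initialRound M) := by
  constructor
  simp only [initialRound, Measure.finsetSum_apply, Measure.smul_apply, smul_eq_mul, measure_univ,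
    mul_one]
  rw [← ENNReal.ofReal_sum_of_nonneg (fun s' _ => stdSimplex.zero_le _ _)]
  simp

instance isProbabilityMeasure_interactionLaw (M : MDP S A) (alg : Algorithm S A) :
    IsProbabilityMeasure (interactionLaw M alg) := by
  unfold interactionLaw
  infer_instance

/-- A single ratio `g` of old and new state serves all three decisions: a halt keeps the state,
where `self` gives 1, and a reset lands in the support of `p0`, where `init` gives 1. -/
lemma lintegral_obsLaw_of_ratio {M₀ M₁ : MDP S A} {g : S → S → ℝ}
    (hg : IsTransitionRatio M₀ M₁ g) (x : Decision S A × S) (F : Obs S A → ℝ≥0∞) :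
    ∫⁻ o, F o ∂M₁.obsLaw x = ∫⁻ o, F o * ENNReal.ofReal (g x.2 o.2) ∂M₀.obsLaw x := by
  obtain ⟨d | ψ | u, s⟩ := x
  · simp [MDP.obsLaw, hg.self]
  · simp only [MDP.obsLaw, lintegral_finsetSum_measure, lintegral_smul_measure, lintegral_dirac,
      smul_eq_mul]
    refine sum_congr rfl fun a _ => sum_congr rfl fun s' _ => ?_
    rw [hg.P_eq, ← mul_assoc, ENNReal.ofReal_mul
      (mul_nonneg (stdSimplex.zero_le _ _) (stdSimplex.zero_le _ _))]
    ring
  · simp only [MDP.obsLaw, lintegral_finsetSum_measure, lintegral_smul_measure, lintegral_dirac,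
      smul_eq_mul, hg.p0_eq]
    refine sum_congr rfl fun s' _ => ?_
    by_cases h : M₀.p0 s' = 0
    · simp [h]
    · simp [hg.init s s' h]

lemma lintegral_roundKernel (M : MDP S A) (alg : Algorithm S A) (n : ℕ)
    (h : (i : Iic n) → Round S A) {F : Round S A → ℝ≥0∞} (hF : Measurable F) :
    ∫⁻ r, F r ∂roundKernel M alg n h =
      ∫⁻ d, ∫⁻ o, F (d, o) ∂M.obsLaw (d, (h ⟨n, mem_Iic.2 le_rfl⟩).2.2) ∂alg.decide n h := by
  have := alg.isMarkov n
  rw [roundKernel, Kernel.lintegral_compProd _ _ _ hF]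
  rfl

/-- The decision kernel is the same for both MDPs, so only the observation contributes to the
density. -/
lemma lintegral_roundKernel_of_ratio {M₀ M₁ : MDP S A} {g : S → S → ℝ}
    (hg : IsTransitionRatio M₀ M₁ g) (alg : Algorithm S A) (n : ℕ)
    (h : (i : Iic n) → Round S A) {F : Round S A → ℝ≥0∞} (hF : Measurable F) :
    ∫⁻ r, F r ∂roundKernel M₁ alg n h =
      ∫⁻ r, F r * ENNReal.ofReal (g (h ⟨n, mem_Iic.2 le_rfl⟩).2.2 r.2.2)
        ∂roundKernel M₀ alg n h := by
  have hm : Measurable fun r : Round S A =>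
      ENNReal.ofReal (g (h ⟨n, mem_Iic.2 le_rfl⟩).2.2 r.2.2) :=
    (measurable_of_finite fun s' : S => ENNReal.ofReal (g _ s')).comp
      (measurable_snd.comp measurable_snd)
  rw [lintegral_roundKernel _ _ _ _ hF, lintegral_roundKernel (F := fun r => F r * _) _ _ _ _
    (hF.mul hm)]
  simp_rw [lintegral_obsLaw_of_ratio hg]

/-- Appends a round to a history. -/
def appendRound (n : ℕ) (x : ((i : Iic n) → Round S A) × Round S A) (i : Iic (n + 1)) :
    Round S A :=
  if hi : i.1 ≤ n then x.1 ⟨i.1, mem_Iic.2 hi⟩ else x.2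

lemma measurable_appendRound (n : ℕ) : Measurable (appendRound (S := S) (A := A) n) := by
  refine measurable_pi_lambda _ fun i => ?_
  by_cases hi : i.1 ≤ n
  · simp only [appendRound, hi, dite_true]
    fun_prop
  · simp only [appendRound, hi, dite_false]
    fun_prop

lemma appendRound_frestrictLe (n : ℕ) (ω : ℕ → Round S A) :
    appendRound n (frestrictLe n ω, ω (n + 1)) = frestrictLe (n + 1) ω := by
  ext1 i
  by_cases hi : i.1 ≤ n
  · simp [appendRound, hi]
  · have h : i.1 = n + 1 := le_antisymm (mem_Iic.1 i.2) (by omega)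
    simp [appendRound, h]

lemma map_interactionLaw (M : MDP S A) (alg : Algorithm S A) (n : ℕ) :
    (interactionLaw M alg).map (fun ω => (frestrictLe n ω, ω (n + 1))) =
      (interactionLaw M alg).map (frestrictLe n) ⊗ₘ roundKernel M alg n :=
  Kernel.map_frestrictLe_trajMeasure_compProd_eq_map_trajMeasure.symm

lemma lintegral_interactionLaw_succ (M : MDP S A) (alg : Algorithm S A) (n : ℕ)
    {F : ((i : Iic n) → Round S A) × Round S A → ℝ≥0∞} (hF : Measurable F) :
    ∫⁻ ω, F (frestrictLe n ω, ω (n + 1)) ∂interactionLaw M alg =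
      ∫⁻ ω, ∫⁻ r, F (frestrictLe n ω, r) ∂roundKernel M alg n (frestrictLe n ω)
        ∂interactionLaw M alg := by
  rw [← lintegral_map (f := F) (g := fun ω : ℕ → Round S A => (frestrictLe n ω, ω (n + 1))) hF
    (by fun_prop), map_interactionLaw, Measure.lintegral_compProd hF,
    lintegral_map (Measurable.lintegral_kernel_prod_right' hF) (by fun_prop)]

/-- The likelihood ratio of the first `n + 1` rounds. -/
def likelihood (g : S → S → ℝ) (n : ℕ) (ω : ℕ → Round S A) : ℝ :=
  ∏ m ∈ range n, g (ω m).2.2 (ω (m + 1)).2.2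

lemma measurable_ratio (g : S → S → ℝ) (m : ℕ) :
    Measurable fun ω : ℕ → Round S A => g (ω m).2.2 (ω (m + 1)).2.2 :=
  (measurable_of_finite fun x : S × S => g x.1 x.2).comp
    (f := fun ω : ℕ → Round S A => ((ω m).2.2, (ω (m + 1)).2.2)) (by fun_prop)

lemma map_zero_interactionLaw (M : MDP S A) (alg : Algorithm S A) :
    (interactionLaw M alg).map (frestrictLe 0) =
      (initialRound M).map (MeasurableEquiv.piUnique fun _ : Iic 0 => Round S A).symm := by
  rw [interactionLaw, Kernel.trajMeasure, Measure.map_comp _ _ (by fun_prop),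
    Kernel.traj_map_frestrictLe, Kernel.partialTraj_self, Measure.id_comp]

/-- Change of measure for functions of the first `n + 1` rounds. -/
lemma lintegral_interactionLaw_of_ratio {M₀ M₁ : MDP S A} {g : S → S → ℝ}
    (hg : IsTransitionRatio M₀ M₁ g) (alg : Algorithm S A) (n : ℕ)
    {F : ((i : Iic n) → Round S A) → ℝ≥0∞} (hF : Measurable F) :
    ∫⁻ ω, F (frestrictLe n ω) ∂interactionLaw M₁ alg =
      ∫⁻ ω, F (frestrictLe n ω) * ENNReal.ofReal (likelihood g n ω) ∂interactionLaw M₀ alg := by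
  induction n with
  | zero =>
    have h : initialRound M₁ = initialRound M₀ := by simp [initialRound, hg.p0_eq]
    simp only [likelihood, range_zero, prod_empty, ENNReal.ofReal_one, mul_one]
    rw [← lintegral_map (g := frestrictLe 0) hF (by fun_prop),
      ← lintegral_map (g := frestrictLe 0) hF (by fun_prop),
      map_zero_interactionLaw, map_zero_interactionLaw, h]
  | succ n ih =>
    have hF' : Measurable fun x => F (appendRound n x) := hF.comp (measurable_appendRound n)
    have hR : Measurable fun x : ((i : Iic n) → Round S A) × Round S A =>
        ENNReal.ofReal (g (x.1 ⟨n, mem_Iic.2 le_rfl⟩).2.2 x.2.2.2) :=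
      (measurable_of_finite fun x : S × S => ENNReal.ofReal (g x.1 x.2)).comp
        (f := fun x : ((i : Iic n) → Round S A) × Round S A =>
          ((x.1 ⟨n, mem_Iic.2 le_rfl⟩).2.2, x.2.2.2)) (by fun_prop)
    -- The likelihood is rewritten as a function of the finite history, so that it can be taken out
    -- of the integral over the next round.
    have hL : Measurable fun h : (i : Iic n) → Round S A => ∏ m : Fin n,
        ENNReal.ofReal (g (h ⟨m, mem_Iic.2 m.2.le⟩).2.2 (h ⟨m + 1, mem_Iic.2 m.2⟩).2.2) :=
      Finset.measurable_prod _ fun m _ =>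
        (measurable_of_finite fun x : S × S => ENNReal.ofReal (g x.1 x.2)).comp
          (f := fun h : (i : Iic n) → Round S A =>
            ((h ⟨m, mem_Iic.2 m.2.le⟩).2.2, (h ⟨m + 1, mem_Iic.2 m.2⟩).2.2)) (by fun_prop)
    have hL' : ∀ ω : ℕ → Round S A, ENNReal.ofReal (likelihood g n ω) = ∏ m : Fin n,
        ENNReal.ofReal (g (frestrictLe n ω ⟨m, mem_Iic.2 m.2.le⟩).2.2
          (frestrictLe n ω ⟨m + 1, mem_Iic.2 m.2⟩).2.2) := fun ω => by
      rw [likelihood, ENNReal.ofReal_prod_of_nonneg fun _ _ => (hg.pos _ _).le,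
        prod_range]
      rfl
    have h1 := lintegral_interactionLaw_succ M₁ alg n hF'
    have h2 := lintegral_interactionLaw_succ M₀ alg n
      ((hF'.mul hR).mul (hL.comp measurable_fst))
    simp only [Function.comp_def, Pi.mul_apply, appendRound_frestrictLe] at h1 h2
    rw [h1, ih (F := fun h => ∫⁻ r, F (appendRound n (h, r)) ∂roundKernel M₁ alg n h)
      (Measurable.lintegral_kernel_prod_right' hF')]
    trans ∫⁻ ω, F (frestrictLe (n + 1) ω) *
        ENNReal.ofReal (g (frestrictLe n ω ⟨n, mem_Iic.2 le_rfl⟩).2.2 (ω (n + 1)).2.2) *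
          ENNReal.ofReal (likelihood g n ω) ∂interactionLaw M₀ alg
    · simp_rw [hL']
      rw [h2]
      refine lintegral_congr fun ω => ?_
      rw [lintegral_mul_const' _ _ (ENNReal.prod_ne_top fun _ _ => ENNReal.ofReal_ne_top)]
      congr 1
      exact lintegral_roundKernel_of_ratio hg alg n _ (hF'.comp measurable_prodMk_left)
    · refine lintegral_congr fun ω => ?_
      rw [mul_assoc, ← ENNReal.ofReal_mul (hg.pos _ _).le, likelihood, likelihood,
        prod_range_succ, mul_comm (g _ _)]
      rfl

end ChangeOfMeasure

/-! ### Change of measure up to the stopping round. -/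

section Stopping

open Preorder Finset

variable {S A : Type*} [Fintype S] [Fintype A] [MeasurableSpace S] [DiscreteMeasurableSpace S]

lemma NotStoppedBefore.mono {ω : ℕ → Round S A} {m n : ℕ} (h : NotStoppedBefore ω n)
    (hmn : m ≤ n) : NotStoppedBefore ω m :=
  fun k hk => h k (hk.trans_le hmn)

/-- No round of the history is a halt. -/
def notHalted (n : ℕ) : Set ((i : Iic n) → Round S A) :=
  {h | ∀ i, ∀ ψ, (h i).1 ≠ Decision.halt ψ}

lemma frestrictLe_mem_notHalted {n : ℕ} {ω : ℕ → Round S A} :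
    frestrictLe n ω ∈ notHalted n ↔ NotStoppedBefore ω (n + 1) :=
  ⟨fun h m hm => h ⟨m, mem_Iic.2 (Nat.lt_succ_iff.1 hm)⟩,
    fun h i => h i (Nat.lt_succ_iff.2 (mem_Iic.1 i.2))⟩

lemma measurableSet_notHalted (n : ℕ) : MeasurableSet (notHalted (S := S) (A := A) n) := by
  have : notHalted (S := S) (A := A) n =
      ⋂ i : Iic n, (fun h : (i : Iic n) → Round S A => (h i).1) ⁻¹' (Set.range Sum.inl)ᶜ := by
    ext h
    simp only [notHalted, Set.mem_ofPred_eq, Set.mem_iInter, Set.mem_preimage, Set.mem_compl_iff,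
      Set.mem_range, not_exists, ne_eq, eq_comm]
  rw [this]
  exact MeasurableSet.iInter fun i => measurableSet_range_inl.compl.preimage (by fun_prop)

lemma measurableSet_notStoppedBefore (n : ℕ) :
    MeasurableSet {ω : ℕ → Round S A | NotStoppedBefore ω n} := by
  cases n with
  | zero => simp [NotStoppedBefore]
  | succ n =>
    have h : {ω : ℕ → Round S A | NotStoppedBefore ω (n + 1)} = frestrictLe n ⁻¹' notHalted n := by
      ext ω
      exact frestrictLe_mem_notHalted.symm
    rw [h]
    exact (measurableSet_notHalted n).preimage (by fun_prop)

/-- The algorithm stops in round `n` and outputs a policy in `B`. -/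
def stopAt (B : Set (Policy S A)) (n : ℕ) : Set (ℕ → Round S A) :=
  {ω | NotStoppedBefore ω n ∧ ∃ ψ ∈ B, (ω n).1 = Decision.halt ψ}

lemma measurableSet_halt_mem {B : Set (Policy S A)} (hB : MeasurableSet B) :
    MeasurableSet {d : Decision S A | ∃ ψ ∈ B, d = Decision.halt ψ} := by
  have h : {d : Decision S A | ∃ ψ ∈ B, d = Decision.halt ψ} = Sum.inl '' B := by
    ext d
    simp [eq_comm]
  rw [h]
  exact hB.inl_image

lemma measurableSet_stopAt {B : Set (Policy S A)} (hB : MeasurableSet B) (n : ℕ) :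
    MeasurableSet (stopAt (S := S) B n) := by
  exact (measurableSet_notStoppedBefore n).inter ((measurableSet_halt_mem hB).preimage
    (f := fun ω : ℕ → Round S A => (ω n).1) (by fun_prop))

lemma exists_outputs_eq_iUnion (B : Set (Policy S A)) :
    {ω : ℕ → Round S A | ∃ ψ, Outputs ω ψ ∧ ψ ∈ B} = ⋃ n, stopAt B n := by
  ext ω
  simp only [Outputs, stopAt, Set.mem_ofPred_eq, Set.mem_iUnion]
  constructor
  · rintro ⟨ψ, ⟨n, h, h'⟩, hψ⟩
    exact ⟨n, h, ψ, hψ, h'⟩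
  · rintro ⟨n, h, ψ, hψ, h'⟩
    exact ⟨ψ, ⟨n, h, h'⟩, hψ⟩

lemma eq_of_mem_stopAt {B C : Set (Policy S A)} {m n : ℕ} {ω : ℕ → Round S A}
    (hm : ω ∈ stopAt B m) (hn : ω ∈ stopAt C n) : m = n := by
  obtain ⟨hm, ψ, -, hψ⟩ := hm
  obtain ⟨hn, θ, -, hθ⟩ := hn
  by_contra h
  rcases lt_or_gt_of_ne h with h | h
  · exact hn _ h _ hψ
  · exact hm _ h _ hθ

/-- The log-likelihood ratio of the rounds until the algorithm stops, but at most until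
round `N`. -/
noncomputable def stoppedLogLikelihood (g : S → S → ℝ) (N : ℕ) (ω : ℕ → Round S A) : ℝ :=
  ∑ m ∈ range N, {ω : ℕ → Round S A | NotStoppedBefore ω (m + 1)}.indicator
    (fun ω => Real.log (g (ω m).2.2 (ω (m + 1)).2.2)) ω

lemma measurable_stoppedLogLikelihood (g : S → S → ℝ) (N : ℕ) :
    Measurable (stoppedLogLikelihood (A := A) g N) :=
  Finset.measurable_sum _ fun m _ =>
    (measurable_ratio (fun s s' => Real.log (g s s')) m).indicator
      (measurableSet_notStoppedBefore _)

/-- The increment from round m to m + 1 is counted iff rounds 0, …, m are not halts. A run that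
halts in round n therefore keeps exactly the increments m < n, and so does one cut off at n = N. -/
lemma exp_stoppedLogLikelihood {g : S → S → ℝ} (hg : ∀ s s', 0 < g s s') {n N : ℕ} (hn : n ≤ N)
    {ω : ℕ → Round S A} (h : NotStoppedBefore ω n)
    (h' : n < N → ∃ ψ, (ω n).1 = Decision.halt ψ) :
    Real.exp (stoppedLogLikelihood g N ω) = likelihood g n ω := by
  rw [stoppedLogLikelihood, ← sum_subset (range_mono hn), likelihood, Real.exp_sum]
  · refine prod_congr rfl fun m hm => ?_
    rw [Set.indicator_of_mem (by exact h.mono (mem_range.1 hm)), Real.exp_log (hg _ _)]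
  · intro m hm hm'
    rw [mem_range] at hm hm'
    obtain ⟨ψ, hψ⟩ := h' (by omega)
    exact Set.indicator_of_notMem
      (fun h'' : NotStoppedBefore ω (m + 1) => h'' n (by omega) ψ hψ) _

lemma setLIntegral_likelihood {M₀ M₁ : MDP S A} {g : S → S → ℝ}
    (hg : IsTransitionRatio M₀ M₁ g) (alg : Algorithm S A) (n : ℕ)
    {T : Set ((i : Iic n) → Round S A)} (hT : MeasurableSet T) :
    ∫⁻ ω in frestrictLe n ⁻¹' T, ENNReal.ofReal (likelihood g n ω) ∂interactionLaw M₀ alg =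
      interactionLaw M₁ alg (frestrictLe n ⁻¹' T) := by
  have hT' : MeasurableSet ((frestrictLe n : (ℕ → Round S A) → _) ⁻¹' T) :=
    hT.preimage (by fun_prop)
  have h := lintegral_interactionLaw_of_ratio hg alg n (measurable_one.indicator hT)
  rw [← lintegral_indicator hT', ← lintegral_indicator_one hT']
  refine Eq.trans (lintegral_congr fun ω => ?_) h.symm
  by_cases hω : frestrictLe n ω ∈ T
  · simp [hω]
  · simp [hω]

/-- Stopping in round n is decided by rounds 0, …, n, which is what makes the fixed-horizon change
of measure applicable. -/
lemma exists_stopAt_eq_preimage {B : Set (Policy S A)} (hB : MeasurableSet B) (n : ℕ) :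
    ∃ T : Set ((i : Iic n) → Round S A), MeasurableSet T ∧
      stopAt B n = frestrictLe n ⁻¹' T := by
  have hlast : MeasurableSet {h : (i : Iic n) → Round S A |
      ∃ ψ ∈ B, (h ⟨n, mem_Iic.2 le_rfl⟩).1 = Decision.halt ψ} :=
    (measurableSet_halt_mem hB).preimage
      (f := fun h : (i : Iic n) → Round S A => (h ⟨n, mem_Iic.2 le_rfl⟩).1) (by fun_prop)
  cases n with
  | zero =>
    refine ⟨_, hlast, ?_⟩
    ext ω
    simp [stopAt, NotStoppedBefore]
  | succ n =>
    refine ⟨_, ((measurableSet_notHalted n).preimage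
      (f := frestrictLe₂ (π := fun _ => Round S A) n.le_succ) (measurable_frestrictLe₂ _)).inter hlast, ?_⟩
    ext ω
    exact and_congr_left' frestrictLe_mem_notHalted.symm

lemma setLIntegral_stopAt {M₀ M₁ : MDP S A} {g : S → S → ℝ}
    (hg : IsTransitionRatio M₀ M₁ g) (alg : Algorithm S A) {B : Set (Policy S A)}
    (hB : MeasurableSet B) {n N : ℕ} (hn : n ≤ N) :
    ∫⁻ ω in stopAt B n, ENNReal.ofReal (Real.exp (stoppedLogLikelihood g N ω))
        ∂interactionLaw M₀ alg =
      interactionLaw M₁ alg (stopAt B n) := by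
  rw [setLIntegral_congr_fun (g := fun ω => ENNReal.ofReal (likelihood g n ω))
    (measurableSet_stopAt hB n)]
  · obtain ⟨T, hT, h⟩ := exists_stopAt_eq_preimage hB n
    rw [h, setLIntegral_likelihood hg alg n hT]
  · rintro ω ⟨h, ψ, -, hψ⟩
    simp only [exp_stoppedLogLikelihood hg.pos hn h fun _ => ⟨ψ, hψ⟩]

lemma setLIntegral_notStopped {M₀ M₁ : MDP S A} {g : S → S → ℝ}
    (hg : IsTransitionRatio M₀ M₁ g) (alg : Algorithm S A) (N : ℕ) :
    ∫⁻ ω in {ω | NotStoppedBefore ω (N + 1)},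
        ENNReal.ofReal (Real.exp (stoppedLogLikelihood g N ω)) ∂interactionLaw M₀ alg =
      interactionLaw M₁ alg {ω | NotStoppedBefore ω (N + 1)} := by
  rw [setLIntegral_congr_fun (g := fun ω => ENNReal.ofReal (likelihood g N ω))
    (measurableSet_notStoppedBefore _)]
  · have h : {ω : ℕ → Round S A | NotStoppedBefore ω (N + 1)} =
        frestrictLe N ⁻¹' notHalted N := by
      ext ω
      exact frestrictLe_mem_notHalted.symm
    rw [h, setLIntegral_likelihood hg alg N (measurableSet_notHalted N)]
  · intro ω h
    simp only [exp_stoppedLogLikelihood hg.pos le_rfl (h.mono N.le_succ) fun h => absurd h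
      (lt_irrefl _)]

/-- The algorithm stops by round `N` and outputs a policy in `B`. -/
def stopBy (B : Set (Policy S A)) (N : ℕ) : Set (ℕ → Round S A) :=
  ⋃ n ∈ range (N + 1), stopAt B n

lemma measurableSet_stopBy {B : Set (Policy S A)} (hB : MeasurableSet B) (N : ℕ) :
    MeasurableSet (stopBy (S := S) B N) :=
  Finset.measurableSet_biUnion _ fun n _ => measurableSet_stopAt hB n

lemma stopBy_mono (B : Set (Policy S A)) : Monotone (stopBy B) := fun _ _ h =>
  Set.biUnion_subset_biUnion_left fun _ hn =>
    mem_range.2 ((mem_range.1 hn).trans_le (Nat.succ_le_succ h))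

lemma iUnion_stopBy (B : Set (Policy S A)) : ⋃ N, stopBy B N = ⋃ n, stopAt B n := by
  ext ω
  simp only [stopBy, Set.mem_iUnion, mem_range]
  exact ⟨fun ⟨_, n, _, h⟩ => ⟨n, h⟩, fun ⟨n, h⟩ => ⟨n, n, n.lt_succ_self, h⟩⟩

/-- The events of stopping in different rounds are disjoint, and one density, stopped at N, is valid
on all of them. -/
lemma setLIntegral_stopBy {M₀ M₁ : MDP S A} {g : S → S → ℝ}
    (hg : IsTransitionRatio M₀ M₁ g) (alg : Algorithm S A) {B : Set (Policy S A)}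
    (hB : MeasurableSet B) (N : ℕ) :
    ∫⁻ ω in stopBy B N, ENNReal.ofReal (Real.exp (stoppedLogLikelihood g N ω))
        ∂interactionLaw M₀ alg =
      interactionLaw M₁ alg (stopBy B N) := by
  have hd : Set.PairwiseDisjoint (range (N + 1) : Set ℕ) (stopAt (S := S) B) :=
    fun m _ n _ hmn => Set.disjoint_left.2 fun ω h h' => hmn (eq_of_mem_stopAt h h')
  rw [stopBy, lintegral_biUnion_finset hd fun n _ => measurableSet_stopAt hB n,
    measure_biUnion_finset hd fun n _ => measurableSet_stopAt hB n]
  exact sum_congr rfl fun n hn =>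
    setLIntegral_stopAt hg alg hB (Nat.lt_succ_iff.1 (mem_range.1 hn))

lemma notStopped_or_mem_stopBy (ω : ℕ → Round S A) (N : ℕ) :
    NotStoppedBefore ω (N + 1) ∨ ω ∈ stopBy Set.univ N := by
  induction N with
  | zero =>
    by_cases h : ∃ ψ, (ω 0).1 = Decision.halt ψ
    · refine Or.inr (Set.mem_biUnion (x := 0) (by simp) ⟨fun m hm => by simp at hm, ?_⟩)
      simpa using h
    · push Not at h
      exact Or.inl fun m hm => by simpa [Nat.lt_one_iff.1 hm] using h
  | succ N ih =>
    rcases ih with ih | ih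
    · by_cases h : ∃ ψ, (ω (N + 1)).1 = Decision.halt ψ
      · refine Or.inr (Set.mem_biUnion (x := N + 1) (by simp) ⟨ih, ?_⟩)
        simpa using h
      · push Not at h
        refine Or.inl fun m hm => ?_
        rcases Nat.lt_succ_iff_lt_or_eq.1 hm with hm | rfl
        · exact ih m hm
        · exact h
    · exact Or.inr (stopBy_mono _ N.le_succ ih)

end Stopping

/-! ### Information gained per transition, and the lower bound on the number of transitions. -/

section TransitionBound

open Preorder Finset

variable {S A : Type*} [Fintype S] [Fintype A] [MeasurableSpace S] [DiscreteMeasurableSpace S]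

/-- The decisions to make a transition. -/
def plays : Set (Decision S A) := {d | ∃ ψ, d = Decision.play ψ}

lemma measurableSet_plays : MeasurableSet (plays (S := S) (A := A)) := by
  have h : plays (S := S) (A := A) = Sum.inr '' Set.range Sum.inl := by
    ext d
    simp [plays, eq_comm]
  rw [h]
  exact measurableSet_range_inl.inr_image

lemma integrable_finite_obsLaw (M : MDP S A) (x : Decision S A × S) (f : S → ℝ) :
    Integrable (fun o : Obs S A => f o.2) (M.obsLaw x) := by
  obtain ⟨C, hC⟩ := (Set.finite_range fun s => ‖f s‖).bddAbove
  exact Integrable.of_bound ((measurable_of_finite f).comp measurable_snd).aestronglyMeasurable C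
    (Filter.Eventually.of_forall fun o => hC ⟨o.2, rfl⟩)

/-- The hypothesis `hκ` bounds by κ the Kullback-Leibler divergence of each transition law.
Averaging over the action played preserves the bound; halts and resets have log-ratio zero almost
surely. -/
lemma integral_log_obsLaw_ge {M₀ M₁ : MDP S A} {g : S → S → ℝ} {κ : ℝ}
    (hg : IsTransitionRatio M₀ M₁ g)
    (hκ : ∀ s a, -κ ≤ ∑ s', M₀.P s a s' * Real.log (g s s')) (x : Decision S A × S) :
    -plays.indicator (fun _ => κ) x.1 ≤ ∫ o, Real.log (g x.2 o.2) ∂M₀.obsLaw x := by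
  obtain ⟨ψ | ψ | u, s⟩ := x
  · rw [Set.indicator_of_notMem (by rintro ⟨θ, h⟩; simp at h)]
    simp [MDP.obsLaw, hg.self]
  · rw [Set.indicator_of_mem (by exact ⟨ψ, rfl⟩)]
    have hi : ∀ a s', Integrable (fun o : Obs S A => Real.log (g s o.2))
        (ENNReal.ofReal (ψ s a * M₀.P s a s') • Measure.dirac (some a, s')) := fun a s' =>
      (integrable_dirac (by simp)).smul_measure ENNReal.ofReal_ne_top
    have h0 : ∀ a s', 0 ≤ ψ s a * M₀.P s a s' := fun a s' =>
      mul_nonneg (stdSimplex.zero_le _ _) (stdSimplex.zero_le _ _)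
    simp only [MDP.obsLaw]
    rw [integral_finsetSum_measure fun a _ => integrable_finsetSum_measure.2 fun s' _ => hi a s']
    simp_rw [integral_finsetSum_measure fun s' (_ : s' ∈ univ) => hi _ s', integral_smul_measure,
      integral_dirac, ENNReal.toReal_ofReal (h0 _ _), smul_eq_mul, mul_assoc, ← mul_sum]
    calc -κ = ∑ a, ψ s a * -κ := by rw [← sum_mul, stdSimplex.sum_eq_one, one_mul]
      _ ≤ _ := sum_le_sum fun a _ => mul_le_mul_of_nonneg_left (hκ s a) (stdSimplex.zero_le _ _)
  · rw [Set.indicator_of_notMem (by rintro ⟨θ, h⟩; simp at h)]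
    simp only [MDP.obsLaw]
    rw [integral_finsetSum_measure fun s' _ =>
      (integrable_dirac (by simp)).smul_measure ENNReal.ofReal_ne_top]
    simp_rw [integral_smul_measure, integral_dirac]
    refine (neg_zero.trans (sum_eq_zero fun s' _ => ?_).symm).le
    by_cases h : M₀.p0 s' = 0
    · simp [h]
    · simp [hg.init s s' h]

lemma integral_roundKernel_nonneg {M₀ M₁ : MDP S A} {g : S → S → ℝ} {κ : ℝ}
    (hg : IsTransitionRatio M₀ M₁ g)
    (hκ : ∀ s a, -κ ≤ ∑ s', M₀.P s a s' * Real.log (g s s')) (alg : Algorithm S A) (n : ℕ)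
    (h : (i : Iic n) → Round S A) :
    0 ≤ ∫ r, (Real.log (g (h ⟨n, mem_Iic.2 le_rfl⟩).2.2 r.2.2) +
      plays.indicator (fun _ => κ) r.1) ∂roundKernel M₀ alg n h := by
  have := alg.isMarkov n
  set s := (h ⟨n, mem_Iic.2 le_rfl⟩).2.2 with hs
  obtain ⟨C, hC⟩ := (Set.finite_range fun s' => ‖Real.log (g s s')‖).bddAbove
  have hint : Integrable (fun r : Round S A => Real.log (g s r.2.2) +
      plays.indicator (fun _ => κ) r.1) (roundKernel M₀ alg n h) := by
    refine Integrable.of_bound (Measurable.aestronglyMeasurable ?_) (C + ‖κ‖)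
      (Filter.Eventually.of_forall fun r => ?_)
    · exact ((measurable_of_finite fun s' => Real.log (g s s')).comp
        (measurable_snd.comp measurable_snd)).add
        ((measurable_const.indicator measurableSet_plays).comp measurable_fst)
    · exact (norm_add_le _ _).trans
        (add_le_add (hC ⟨r.2.2, rfl⟩) (norm_indicator_le_norm_self _ _))
  rw [roundKernel, ProbabilityTheory.integral_compProd hint]
  refine integral_nonneg fun d => ?_
  have h1 : Integrable (fun o : Obs S A => Real.log (g s o.2)) (M₀.obsLaw (d, s)) :=
    integrable_finite_obsLaw M₀ (d, s) fun s' => Real.log (g s s')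
  have h2 := integral_log_obsLaw_ge hg hκ (d, s)
  change 0 ≤ ∫ o, (Real.log (g s o.2) + plays.indicator (fun _ => κ) d) ∂M₀.obsLaw (d, s)
  rw [integral_add h1 (integrable_const _)]
  simp only [integral_const, probReal_univ, one_smul]
  linarith

/-- The rounds in which a transition is made before the algorithm stops. -/
def transitionAt (n : ℕ) : Set (ℕ → Round S A) := {ω | NotStoppedBefore ω n ∧ (ω n).1 ∈ plays}

lemma measurableSet_transitionAt (n : ℕ) : MeasurableSet (transitionAt (S := S) (A := A) n) :=
  (measurableSet_notStoppedBefore n).inter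
    (measurableSet_plays.preimage (f := fun ω : ℕ → Round S A => (ω n).1) (by fun_prop))

lemma integrable_indicator_log (g : S → S → ℝ) (n : ℕ) (μ : Measure (ℕ → Round S A))
    [IsProbabilityMeasure μ] :
    Integrable ({ω : ℕ → Round S A | NotStoppedBefore ω (n + 1)}.indicator
      fun ω => Real.log (g (ω n).2.2 (ω (n + 1)).2.2)) μ := by
  obtain ⟨C, hC⟩ := (Set.finite_range fun x : S × S => ‖Real.log (g x.1 x.2)‖).bddAbove
  refine (Integrable.of_bound
    (measurable_ratio (fun s s' => Real.log (g s s')) n).aestronglyMeasurable C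
    (Filter.Eventually.of_forall fun ω => ?_)).indicator (measurableSet_notStoppedBefore _)
  exact hC ⟨((ω n).2.2, (ω (n + 1)).2.2), rfl⟩

/-- This is the one-step submartingale property of ℓ + κ · (number of transitions), stopped at the
halt. It holds because not having halted through round n is known before round n + 1 is drawn. -/
lemma integral_indicator_log_ge {M₀ M₁ : MDP S A} {g : S → S → ℝ} {κ : ℝ}
    (hg : IsTransitionRatio M₀ M₁ g)
    (hκ : ∀ s a, -κ ≤ ∑ s', M₀.P s a s' * Real.log (g s s')) (alg : Algorithm S A) (n : ℕ) :
    -(κ * (interactionLaw M₀ alg).real (transitionAt (n + 1))) ≤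
      ∫ ω, {ω : ℕ → Round S A | NotStoppedBefore ω (n + 1)}.indicator
        (fun ω => Real.log (g (ω n).2.2 (ω (n + 1)).2.2)) ω ∂interactionLaw M₀ alg := by
  set H : ((i : Iic n) → Round S A) × Round S A → ℝ := fun x => (notHalted n).indicator
    (fun h => Real.log (g (h ⟨n, mem_Iic.2 le_rfl⟩).2.2 x.2.2.2) +
      plays.indicator (fun _ => κ) x.2.1) x.1 with hH
  have hHω : ∀ ω : ℕ → Round S A, H (frestrictLe n ω, ω (n + 1)) =
      {ω : ℕ → Round S A | NotStoppedBefore ω (n + 1)}.indicator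
        (fun ω => Real.log (g (ω n).2.2 (ω (n + 1)).2.2)) ω +
      (transitionAt (n + 1)).indicator (fun _ => κ) ω := by
    intro ω
    by_cases h : NotStoppedBefore ω (n + 1)
    · rw [hH, Set.indicator_of_mem (s := {ω | NotStoppedBefore ω (n + 1)}) h]
      simp only [Set.indicator_of_mem (frestrictLe_mem_notHalted.2 h)]
      congr 1
      by_cases hp : (ω (n + 1)).1 ∈ plays
      · rw [Set.indicator_of_mem hp, Set.indicator_of_mem (by exact ⟨h, hp⟩)]
      · rw [Set.indicator_of_notMem hp, Set.indicator_of_notMem (by exact fun h' => hp h'.2)]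
    · rw [hH, Set.indicator_of_notMem (s := {ω | NotStoppedBefore ω (n + 1)}) h,
        Set.indicator_of_notMem (s := transitionAt (n + 1)) (fun h' => h h'.1)]
      simp only [Set.indicator_of_notMem (fun h' => h (frestrictLe_mem_notHalted.1 h')), add_zero]
  have hHm : Measurable H := by
    have h1 : Measurable fun x : ((i : Iic n) → Round S A) × Round S A =>
        Real.log (g (x.1 ⟨n, mem_Iic.2 le_rfl⟩).2.2 x.2.2.2) +
          plays.indicator (fun _ => κ) x.2.1 :=
      ((measurable_of_finite fun x : S × S => Real.log (g x.1 x.2)).comp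
        (f := fun x : ((i : Iic n) → Round S A) × Round S A =>
          ((x.1 ⟨n, mem_Iic.2 le_rfl⟩).2.2, x.2.2.2)) (by fun_prop)).add
        ((measurable_const.indicator measurableSet_plays).comp
          (f := fun x : ((i : Iic n) → Round S A) × Round S A => x.2.1) (by fun_prop))
    exact h1.indicator ((measurableSet_notHalted n).preimage measurable_fst)
  have hi1 := integrable_indicator_log g n (interactionLaw M₀ alg)
  have hi2 : Integrable ((transitionAt (n + 1)).indicator fun _ => κ) (interactionLaw M₀ alg) :=
    (integrable_const κ).indicator (measurableSet_transitionAt _)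
  have hmeas : Measurable fun ω : ℕ → Round S A => (frestrictLe n ω, ω (n + 1)) := by fun_prop
  have hint : Integrable H
      ((interactionLaw M₀ alg).map (frestrictLe n) ⊗ₘ roundKernel M₀ alg n) := by
    rw [← map_interactionLaw, integrable_map_measure hHm.aestronglyMeasurable hmeas.aemeasurable]
    exact (hi1.add hi2).congr (Filter.Eventually.of_forall fun ω => (hHω ω).symm)
  -- Integrating over round n + 1 first leaves, for each history, either 0 or the nonnegative
  -- one-round drift.
  have key : 0 ≤ ∫ ω, H (frestrictLe n ω, ω (n + 1)) ∂interactionLaw M₀ alg := by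
    rw [← integral_map (f := H) hmeas.aemeasurable hHm.aestronglyMeasurable, map_interactionLaw,
      Measure.integral_compProd hint]
    refine integral_nonneg fun h => ?_
    by_cases hh : h ∈ notHalted n
    · simp only [hH, Set.indicator_of_mem hh]
      exact integral_roundKernel_nonneg hg hκ alg n h
    · simp [hH, Set.indicator_of_notMem hh]
  simp_rw [hHω] at key
  rw [integral_add hi1 hi2, integral_indicator (measurableSet_transitionAt _)] at key
  simp only [integral_const, measureReal_restrict_apply_univ, smul_eq_mul] at key
  linarith

/-- Indices start at n + 1 because round 0 is the initial draw; omitting it can only lower the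
count. -/
lemma sum_indicator_le_numTransitions (ω : ℕ → Round S A) (N : ℕ) :
    ∑ n ∈ range N, (transitionAt (n + 1)).indicator (1 : (ℕ → Round S A) → ℝ≥0∞) ω ≤
      (numTransitions ω : ℝ≥0∞) := by
  classical
  have h : ∑ n ∈ range N, (transitionAt (n + 1)).indicator (1 : (ℕ → Round S A) → ℝ≥0∞) ω =
      ((((range N).filter fun n => ω ∈ transitionAt (n + 1)).map
        ⟨_, Nat.succ_injective⟩).card : ℝ≥0∞) := by
    simp [Set.indicator_apply]
  rw [h, numTransitions]
  have h2 := Set.encard_coe_eq_coe_finsetCard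
    (((range N).filter fun n => ω ∈ transitionAt (n + 1)).map ⟨_, Nat.succ_injective⟩)
  rw [← ENat.toENNReal_coe, ← h2, ENat.toENNReal_le]
  refine Set.encard_le_encard fun m hm => ?_
  simp only [coe_map, Function.Embedding.coeFn_mk, Set.mem_image, coe_filter, mem_range,
    Set.mem_ofPred_eq] at hm
  obtain ⟨n, ⟨-, h⟩, rfl⟩ := hm
  exact h

lemma sum_measure_transitionAt_le (μ : Measure (ℕ → Round S A)) (N : ℕ) :
    ∑ n ∈ range N, μ (transitionAt (n + 1)) ≤ ∫⁻ ω, (numTransitions ω : ℝ≥0∞) ∂μ := by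
  calc ∑ n ∈ range N, μ (transitionAt (n + 1))
      = ∫⁻ ω, ∑ n ∈ range N, (transitionAt (n + 1)).indicator 1 ω ∂μ := by
        rw [lintegral_finsetSum _ fun n _ =>
          measurable_one.indicator (measurableSet_transitionAt (n + 1))]
        exact sum_congr rfl fun n _ =>
          (lintegral_indicator_one (measurableSet_transitionAt (n + 1))).symm
    _ ≤ _ := lintegral_mono fun ω => sum_indicator_le_numTransitions ω N

lemma integrable_stoppedLogLikelihood (g : S → S → ℝ) (N : ℕ) (μ : Measure (ℕ → Round S A))
    [IsProbabilityMeasure μ] : Integrable (stoppedLogLikelihood g N) μ :=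
  integrable_finsetSum _ fun n _ => integrable_indicator_log g n μ

lemma integral_stoppedLogLikelihood_ge {M₀ M₁ : MDP S A} {g : S → S → ℝ} {κ : ℝ}
    (hg : IsTransitionRatio M₀ M₁ g)
    (hκ : ∀ s a, -κ ≤ ∑ s', M₀.P s a s' * Real.log (g s s')) (alg : Algorithm S A) (N : ℕ) :
    -(κ * ∑ n ∈ range N, (interactionLaw M₀ alg).real (transitionAt (n + 1))) ≤
      ∫ ω, stoppedLogLikelihood g N ω ∂interactionLaw M₀ alg := by
  simp only [stoppedLogLikelihood]
  rw [integral_finsetSum _ fun n _ => integrable_indicator_log g n _, mul_sum, ← sum_neg_distrib]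
  exact sum_le_sum fun n _ => integral_indicator_log_ge hg hκ alg n

/-- Not having halted by round N, and having halted by then, each contribute a probability under
`M₁`. The crude constant 2 suffices and spares the disjointness. -/
lemma lintegral_exp_stoppedLogLikelihood_le {M₀ M₁ : MDP S A} {g : S → S → ℝ}
    (hg : IsTransitionRatio M₀ M₁ g) (alg : Algorithm S A) (N : ℕ) :
    ∫⁻ ω, ENNReal.ofReal (Real.exp (stoppedLogLikelihood g N ω)) ∂interactionLaw M₀ alg ≤ 2 := by
  have h : (Set.univ : Set (ℕ → Round S A)) ⊆
      {ω | NotStoppedBefore ω (N + 1)} ∪ stopBy Set.univ N := fun ω _ =>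
    notStopped_or_mem_stopBy ω N
  rw [← setLIntegral_univ]
  refine (lintegral_mono_set h).trans ((lintegral_union_le _ _ _).trans ?_)
  rw [setLIntegral_notStopped hg, setLIntegral_stopBy hg alg MeasurableSet.univ,
    ← one_add_one_eq_two]
  exact add_le_add prob_le_one prob_le_one

/-- If the outputs of the algorithm tell two MDPs apart, then many transitions are made. -/
theorem ofReal_le_mul_lintegral_numTransitions {M₀ M₁ : MDP S A} {g : S → S → ℝ} {κ δ : ℝ}
    (hg : IsTransitionRatio M₀ M₁ g)
    (hκ : ∀ s a, -κ ≤ ∑ s', M₀.P s a s' * Real.log (g s s')) (hκ0 : 0 ≤ κ)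
    (hδ : 0 < δ) (hδ1 : δ ≤ 1) (alg : Algorithm S A) {B : Set (Policy S A)} (hB : MeasurableSet B)
    (h0 : 1 / 2 < interactionLaw M₀ alg (⋃ n, stopAt B n))
    (h1 : interactionLaw M₁ alg (⋃ n, stopAt B n) ≤ ENNReal.ofReal δ) :
    ENNReal.ofReal (1 / 2 * Real.log (1 / δ) - 3) ≤
      ENNReal.ofReal κ * ∫⁻ ω, (numTransitions ω : ℝ≥0∞) ∂interactionLaw M₀ alg := by
  set μ := interactionLaw M₀ alg with hμ
  -- The strict inequality in `h0` survives at a finite horizon, by continuity from below.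
  obtain ⟨N, hN⟩ : ∃ N, 1 / 2 < μ (stopBy B N) := by
    rw [← iUnion_stopBy, (stopBy_mono B).measure_iUnion] at h0
    exact lt_iSup_iff.1 h0
  have hE := measurableSet_stopBy hB N
  set ℓ := stoppedLogLikelihood (A := A) g N with hℓ
  have hmexp : Measurable fun ω => Real.exp (ℓ ω) :=
    (measurable_stoppedLogLikelihood g N).exp
  have htot : ∫⁻ ω, ENNReal.ofReal (Real.exp (ℓ ω)) ∂μ ≤ 2 :=
    lintegral_exp_stoppedLogLikelihood_le hg alg N
  have hpart : ∫⁻ ω in stopBy B N, ENNReal.ofReal (Real.exp (ℓ ω)) ∂μ ≤ ENNReal.ofReal δ := by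
    rw [setLIntegral_stopBy hg alg hB]
    exact (measure_mono (iUnion_stopBy B ▸ Set.subset_iUnion _ N)).trans h1
  have hexp0 : ∀ ν : Measure (ℕ → Round S A), 0 ≤ᵐ[ν] fun ω => Real.exp (ℓ ω) := fun ν =>
    Filter.Eventually.of_forall fun ω => (Real.exp_pos _).le
  have hiexp : Integrable (fun ω => Real.exp (ℓ ω)) μ :=
    ⟨hmexp.aestronglyMeasurable, (hasFiniteIntegral_iff_ofReal (hexp0 μ)).2
      (htot.trans_lt (by simp))⟩
  have htot' : ∫ ω, Real.exp (ℓ ω) ∂μ ≤ 2 := by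
    rw [integral_eq_lintegral_of_nonneg_ae (hexp0 μ) hmexp.aestronglyMeasurable]
    exact ENNReal.toReal_le_of_le_ofReal (by norm_num) (by simpa using htot)
  have hpart' : ∫ ω in stopBy B N, Real.exp (ℓ ω) ∂μ ≤ δ := by
    rw [integral_eq_lintegral_of_nonneg_ae (hexp0 _) hmexp.aestronglyMeasurable]
    exact ENNReal.toReal_le_of_le_ofReal hδ.le hpart
  have hp : 1 / 2 ≤ μ.real (stopBy B N) := by
    have := ENNReal.toReal_mono (measure_ne_top μ _) hN.le
    simpa [Measure.real] using this
  -- The inequality t + 1 ≤ exp t is used twice: with t = ℓ off the event, and with t = ℓ - log δ on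
  -- it, where exp t = δ⁻¹ exp ℓ has integral at most 1.
  have hpt : ∀ ω, ℓ ω ≤ Real.exp (ℓ ω) + (stopBy B N).indicator
      (fun ω => δ⁻¹ * Real.exp (ℓ ω) + (Real.log δ - 1)) ω := by
    intro ω
    by_cases hω : ω ∈ stopBy B N
    · rw [Set.indicator_of_mem hω]
      have h := Real.add_one_le_exp (ℓ ω - Real.log δ)
      rw [Real.exp_sub, Real.exp_log hδ, div_eq_inv_mul] at h
      linarith [Real.exp_pos (ℓ ω)]
    · rw [Set.indicator_of_notMem hω, add_zero]
      linarith [Real.add_one_le_exp (ℓ ω)]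
  have hi2 : Integrable (fun ω => δ⁻¹ * Real.exp (ℓ ω) + (Real.log δ - 1)) μ :=
    (hiexp.const_mul _).add (integrable_const _)
  have hineq := integral_mono (integrable_stoppedLogLikelihood g N μ)
    (hiexp.add (hi2.indicator hE)) hpt
  simp only [Pi.add_apply] at hineq
  rw [integral_add hiexp (hi2.indicator hE), integral_indicator hE,
    integral_add (hiexp.const_mul _).integrableOn (integrable_const _), integral_const_mul] at hineq
  simp only [integral_const, measureReal_restrict_apply_univ, smul_eq_mul] at hineq
  have hlow := (integral_stoppedLogLikelihood_ge hg hκ alg N).trans hineq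
  have hlog : Real.log δ ≤ 0 := Real.log_nonpos hδ.le hδ1
  have hδ' : δ⁻¹ * ∫ ω in stopBy B N, Real.exp (ℓ ω) ∂μ ≤ 1 := by
    rw [inv_mul_le_iff₀ hδ]
    linarith
  -- The factor log δ - 1 is negative, so the lower bound 1/2 on the probability gives an upper
  -- bound here.
  have hp' : μ.real (stopBy B N) * (Real.log δ - 1) ≤ 1 / 2 * Real.log δ := by
    nlinarith
  -- The constant 3 is 2 from the total integral of exp ℓ plus 1 from its rescaled part on the
  -- event.
  have hreal : 1 / 2 * Real.log (1 / δ) - 3 ≤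
      κ * ∑ n ∈ range N, μ.real (transitionAt (n + 1)) := by
    rw [one_div δ, Real.log_inv]
    linarith
  refine (ENNReal.ofReal_le_ofReal hreal).trans ?_
  rw [ENNReal.ofReal_mul hκ0, ENNReal.ofReal_sum_of_nonneg fun _ _ => measureReal_nonneg]
  simp_rw [ofReal_measureReal (measure_ne_top μ _)]
  gcongr
  exact sum_measure_transitionAt_le μ N

end TransitionBound

/-! ### Occupancy of sets of states and total variation. -/

section StateOccupancy

variable {S A : Type*} [Fintype S] [Fintype A]

lemma stateDist_nonneg (M : MDP S A) (φ : Policy S A) (n : ℕ) (s : S) : 0 ≤ stateDist M φ n s := by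
  induction n generalizing s with
  | zero => exact stdSimplex.zero_le _ _
  | succ n ih =>
    exact Finset.sum_nonneg fun t _ => mul_nonneg (ih t) (Finset.sum_nonneg fun a _ =>
      mul_nonneg (stdSimplex.zero_le _ _) (stdSimplex.zero_le _ _))

lemma sum_stateDist (M : MDP S A) (φ : Policy S A) (n : ℕ) : ∑ s, stateDist M φ n s = 1 := by
  induction n with
  | zero => exact stdSimplex.sum_eq_one _
  | succ n ih =>
    simp only [stateDist]
    rw [Finset.sum_comm]
    simp_rw [← Finset.mul_sum]
    rw [← ih]
    refine Finset.sum_congr rfl fun t _ => ?_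
    rw [Finset.sum_comm]
    simp_rw [← Finset.mul_sum]
    simp

lemma stateDist_le_one (M : MDP S A) (φ : Policy S A) (n : ℕ) (s : S) : stateDist M φ n s ≤ 1 :=
  sum_stateDist M φ n ▸
    Finset.single_le_sum (fun t _ => stateDist_nonneg M φ n t) (Finset.mem_univ s)

lemma summable_mul_stateDist (M : MDP S A) (φ : Policy S A) {γ : ℝ} (hγ0 : 0 ≤ γ) (hγ1 : γ < 1)
    (s : S) : Summable fun n => γ ^ n * stateDist M φ n s :=
  Summable.of_nonneg_of_le (fun n => mul_nonneg (pow_nonneg hγ0 n) (stateDist_nonneg M φ n s))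
    (fun n => mul_le_of_le_one_right (pow_nonneg hγ0 n) (stateDist_le_one M φ n s))
    (summable_geometric_of_lt_one hγ0 hγ1)

lemma sum_occupancy_eq (M : MDP S A) (φ : Policy S A) (γ : ℝ) (s : S) :
    ∑ a, occupancy M γ φ (s, a) = (1 - γ) * ∑' n, γ ^ n * stateDist M φ n s := by
  have h : ∀ a, occupancy M γ φ (s, a) =
      φ s a * ((1 - γ) * ∑' n, γ ^ n * stateDist M φ n s) := fun a => by
    simp only [occupancy]
    simp_rw [mul_left_comm (γ ^ _) (φ s a)]
    rw [tsum_mul_left]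
    ring
  simp_rw [h, ← Finset.sum_mul]
  simp

/-- The occupancy of a set of states whose probability is `0` initially and `m` ever after. -/
lemma sum_sum_occupancy_eq (M : MDP S A) (φ : Policy S A) {γ m : ℝ} (hγ0 : 0 ≤ γ) (hγ1 : γ < 1)
    (Z : Finset S) (h0 : ∑ s ∈ Z, stateDist M φ 0 s = 0)
    (h1 : ∀ n, ∑ s ∈ Z, stateDist M φ (n + 1) s = m) :
    ∑ s ∈ Z, ∑ a, occupancy M γ φ (s, a) = γ * m := by
  have hs := fun s (_ : s ∈ Z) => summable_mul_stateDist M φ hγ0 hγ1 s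
  simp_rw [sum_occupancy_eq, ← Finset.mul_sum]
  rw [← Summable.tsum_finsetSum hs]
  simp_rw [← Finset.mul_sum]
  have hs' := summable_sum hs
  simp_rw [← Finset.mul_sum] at hs'
  -- With the term n = 0 gone, what remains is (1 - γ) Σ γ^(n+1) m = γ m.
  rw [hs'.tsum_eq_zero_add, h0]
  simp_rw [h1, pow_succ]
  rw [tsum_mul_right, tsum_mul_right, tsum_geometric_of_lt_one hγ0 hγ1]
  have : 1 - γ ≠ 0 := by linarith
  field_simp
  ring

/-- Merging points and discarding the rest can only decrease total variation. Two classes are kept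
because the deviation in each counts only half. -/
lemma abs_sum_add_abs_sum_le_totalVariation [DecidableEq S] (p q : S × A → ℝ) {Z W : Finset S}
    (h : Disjoint Z W) :
    1 / 2 * (|∑ s ∈ Z, ∑ a, p (s, a) - ∑ s ∈ Z, ∑ a, q (s, a)| +
      |∑ s ∈ W, ∑ a, p (s, a) - ∑ s ∈ W, ∑ a, q (s, a)|) ≤ totalVariation p q := by
  have key : ∀ Y : Finset S, |∑ s ∈ Y, ∑ a, p (s, a) - ∑ s ∈ Y, ∑ a, q (s, a)| ≤
      ∑ s ∈ Y, ∑ a, |p (s, a) - q (s, a)| := fun Y => by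
    simp_rw [← Finset.sum_sub_distrib]
    exact (Finset.abs_sum_le_sum_abs _ _).trans
      (Finset.sum_le_sum fun s _ => Finset.abs_sum_le_sum_abs _ _)
  rw [totalVariation, Fintype.sum_prod_type]
  refine mul_le_mul_of_nonneg_left ((add_le_add (key Z) (key W)).trans ?_) (by norm_num)
  rw [← Finset.sum_union h]
  exact Finset.sum_le_univ_sum_of_nonneg fun s => Finset.sum_nonneg fun a _ => abs_nonneg _

end StateOccupancy

/-! ### The bandit-like MDP: loss, likelihood ratio and divergence. -/

section Bandit

open BState BAction

lemma sum_bAction (f : BAction → ℝ) : ∑ a, f a = f r + f b := by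
  have : (Finset.univ : Finset BAction) = {r, b} := rfl
  rw [this]
  simp

lemma target_alignment_zero (α β : unitInterval) :
    (banditMDP α β).target (alignment 0) = banditMDP α β := rfl

/-- Exchanging x and y preserves the first step, since the actions at `y0` are already reversed
relative to `x0`; only the roles of α and β change. -/
lemma target_alignment_one (α β : unitInterval) :
    (banditMDP α β).target (alignment 1) = banditMDP β α := by
  simp only [MDP.target, banditMDP, MDP.mk.injEq]
  constructor
  · funext s a
    refine Subtype.ext (funext fun s' => ?_)
    cases s <;> cases a <;> cases s' <;> rfl
  · refine Subtype.ext (funext fun s' => ?_)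
    cases s' <;> rfl

/-- The probability of moving to `x1` in the first step. -/
noncomputable def probX (ψ : Policy BState BAction) : ℝ := (ψ x0 r + ψ y0 b) / 2

lemma policy_r_add_b (ψ : Policy BState BAction) (s : BState) : ψ s r + ψ s b = 1 := by
  rw [← sum_bAction, stdSimplex.sum_eq_one]

lemma banditMDP_P (α β : unitInterval) (s : BState) (a : BAction) (s' : BState) :
    (banditMDP α β).P s a s' = banditProb α β s a s' := rfl

lemma stateDist_banditMDP_zero (α β : unitInterval) (ψ : Policy BState BAction) (s : BState) :
    stateDist (banditMDP α β) ψ 0 s = banditInit s := rfl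

/-- Each class is entered only in the first step and never left, so its mass depends neither on n
nor on α, β. -/
lemma stateDist_banditMDP_succ (α β : unitInterval) (ψ : Policy BState BAction) (n : ℕ) :
    stateDist (banditMDP α β) ψ (n + 1) x0 = 0 ∧ stateDist (banditMDP α β) ψ (n + 1) y0 = 0 ∧
    stateDist (banditMDP α β) ψ (n + 1) x1 + stateDist (banditMDP α β) ψ (n + 1) x2 +
      stateDist (banditMDP α β) ψ (n + 1) x3 = probX ψ ∧
    stateDist (banditMDP α β) ψ (n + 1) y1 + stateDist (banditMDP α β) ψ (n + 1) y2 +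
      stateDist (banditMDP α β) ψ (n + 1) y3 = 1 - probX ψ := by
  have h := policy_r_add_b ψ
  induction n with
  | zero =>
    simp only [stateDist, sum_bState, sum_bAction, banditMDP_P, banditProb]
    simp only [show ∀ s, (banditMDP α β).p0 s = banditInit s from fun _ => rfl, banditInit, probX]
    refine ⟨by ring, by ring, by ring, ?_⟩
    linarith [h x0, h y0]
  | succ n ih =>
    obtain ⟨h1, h2, h3, h4⟩ := ih
    rw [stateDist]
    simp only [sum_bState, sum_bAction, banditMDP_P, banditProb, h1, h2, mul_zero, mul_one,
      add_zero, zero_add, zero_mul, ← add_mul, h]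
    refine ⟨trivial, trivial, ?_, ?_⟩ <;> linarith

lemma sum_occupancy_x (α β : unitInterval) (ψ : Policy BState BAction) {γ : ℝ} (hγ0 : 0 ≤ γ)
    (hγ1 : γ < 1) :
    ∑ s ∈ {x1, x2, x3}, ∑ a, occupancy (banditMDP α β) γ ψ (s, a) = γ * probX ψ := by
  refine sum_sum_occupancy_eq _ _ hγ0 hγ1 _ ?_ fun n => ?_
  · simp [stateDist_banditMDP_zero, banditInit]
  · rw [← (stateDist_banditMDP_succ α β ψ n).2.2.1]
    simp [add_assoc]

lemma sum_occupancy_y (α β : unitInterval) (ψ : Policy BState BAction) {γ : ℝ} (hγ0 : 0 ≤ γ)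
    (hγ1 : γ < 1) :
    ∑ s ∈ {y1, y2, y3}, ∑ a, occupancy (banditMDP α β) γ ψ (s, a) = γ * (1 - probX ψ) := by
  refine sum_sum_occupancy_eq _ _ hγ0 hγ1 _ ?_ fun n => ?_
  · simp [stateDist_banditMDP_zero, banditInit]
  · rw [← (stateDist_banditMDP_succ α β ψ n).2.2.2]
    simp [add_assoc]

lemma imitationLoss_zero_ge (α β : unitInterval) {φ : Policy BState BAction} (hφ : probX φ = 1)
    (ψ : Policy BState BAction) {γ : ℝ} (hγ0 : 0 ≤ γ) (hγ1 : γ < 1) :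
    γ * (1 - probX ψ) ≤ imitationLoss (banditMDP α β) γ φ (alignment 0) ψ := by
  refine le_trans ?_ (abs_sum_add_abs_sum_le_totalVariation _ _
    (show Disjoint ({x1, x2, x3} : Finset BState) {y1, y2, y3} by decide))
  simp only [target_alignment_zero]
  change _ ≤ 1 / 2 * (|∑ s ∈ {x1, x2, x3}, ∑ a, occupancy (banditMDP α β) γ φ (s, a) - _| +
    |∑ s ∈ {y1, y2, y3}, ∑ a, occupancy (banditMDP α β) γ φ (s, a) - _|)
  rw [sum_occupancy_x _ _ _ hγ0 hγ1, sum_occupancy_x _ _ _ hγ0 hγ1,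
    sum_occupancy_y _ _ _ hγ0 hγ1, sum_occupancy_y _ _ _ hγ0 hγ1, hφ]
  have h1 := le_abs_self (γ * 1 - γ * probX ψ)
  have h2 := neg_le_abs (γ * (1 - 1) - γ * (1 - probX ψ))
  refine le_trans (le_of_eq ?_) (mul_le_mul_of_nonneg_left (add_le_add h1 h2) (by norm_num))
  ring

/-- Transported along the exchange, the expert's later occupancy lies on the y-class, so here all
mass sent to the x-class is lost. -/
lemma imitationLoss_one_ge (α β : unitInterval) {φ : Policy BState BAction} (hφ : probX φ = 1)
    (ψ : Policy BState BAction) {γ : ℝ} (hγ0 : 0 ≤ γ) (hγ1 : γ < 1) :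
    γ * probX ψ ≤ imitationLoss (banditMDP α β) γ φ (alignment 1) ψ := by
  refine le_trans ?_ (abs_sum_add_abs_sum_le_totalVariation _ _
    (show Disjoint ({x1, x2, x3} : Finset BState) {y1, y2, y3} by decide))
  simp only [target_alignment_one]
  have hx := sum_occupancy_x α β φ hγ0 hγ1
  have hy := sum_occupancy_y α β φ hγ0 hγ1
  have hx' : ∑ s ∈ {x1, x2, x3}, ∑ a, occupancy (banditMDP α β) γ φ (alignment 1 s, a) =
      γ * (1 - probX φ) := by
    rw [← hy]
    simp [alignment, swapXY]
  have hy' : ∑ s ∈ {y1, y2, y3}, ∑ a, occupancy (banditMDP α β) γ φ (alignment 1 s, a) =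
      γ * probX φ := by
    rw [← hx]
    simp [alignment, swapXY]
  rw [hx', hy', sum_occupancy_x _ _ _ hγ0 hγ1, sum_occupancy_y _ _ _ hγ0 hγ1, hφ]
  have h1 := neg_le_abs (γ * (1 - 1) - γ * probX ψ)
  have h2 := le_abs_self (γ * 1 - γ * (1 - probX ψ))
  refine le_trans (le_of_eq ?_) (mul_le_mul_of_nonneg_left (add_le_add h1 h2) (by norm_num))
  ring

lemma measurable_probX : Measurable probX := by
  have h : ∀ s a, Measurable fun ψ : Policy BState BAction => ψ s a := fun s a =>
    (measurable_pi_apply a).comp (measurable_subtype_coe.comp (measurable_pi_apply s))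
  exact ((h _ _).add (h _ _)).div_const _

/-- The ratio of the transition probabilities of the two bandit-like MDPs. -/
noncomputable def banditRatio (α β : ℝ) : BState → BState → ℝ
  | x1, x2 => β / α
  | x1, x3 => α / β
  | y1, y2 => α / β
  | y1, y3 => β / α
  | _, _ => 1

lemma isTransitionRatio_banditRatio {α β : unitInterval} (hα : 0 < (α : ℝ)) (hβ : 0 < (β : ℝ))
    (h : (α : ℝ) + β = 1) :
    IsTransitionRatio (banditMDP α β) (banditMDP β α) (banditRatio α β) where
  pos s s' := by cases s <;> cases s' <;> simp only [banditRatio] <;> positivity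
  self s := by cases s <;> rfl
  init s s' h' := by
    have h'' : banditInit s' ≠ 0 := h'
    cases s' <;> first | (exact absurd rfl h'') | (cases s <;> rfl)
  p0_eq := rfl
  P_eq s a s' := by
    have h1 : 1 - (α : ℝ) = β := by linarith
    have h2 : 1 - (β : ℝ) = α := by linarith
    rw [banditMDP_P, banditMDP_P]
    cases s <;> cases s' <;> cases a <;> simp only [banditProb, banditRatio, h1, h2, mul_one] <;>
      field_simp

/-- At `x1` and `y1` the divergence between the Bernoulli laws is (α - β) log(α / β) ≤ 2ε · 8ε,
using log t ≤ t - 1 and β ≥ 1/4. At all other states it is zero. -/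
lemma sum_mul_log_banditRatio_ge {α β : unitInterval} {ε : ℝ} (hε : 0 ≤ ε) (hε' : ε ≤ 1 / 4)
    (hα : (α : ℝ) = 1 / 2 + ε) (hβ : (β : ℝ) = 1 / 2 - ε) (s : BState) (a : BAction) :
    -(16 * ε ^ 2) ≤ ∑ s', (banditMDP α β).P s a s' * Real.log (banditRatio α β s s') := by
  have hα0 : 0 < (α : ℝ) := by linarith
  have hβ0 : 0 < (β : ℝ) := by linarith
  have hlog : Real.log (α / β) ≤ 8 * ε := by
    refine (Real.log_le_sub_one_of_pos (by positivity)).trans ?_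
    rw [sub_le_iff_le_add, div_le_iff₀ hβ0, hα, hβ]
    nlinarith
  have hlog' : Real.log (β / α) = -Real.log (α / β) := by rw [← Real.log_inv, inv_div]
  have h1 : 1 - (α : ℝ) = β := by linarith
  have h2 : 1 - (β : ℝ) = α := by linarith
  have key : -(16 * ε ^ 2) ≤ -((α - β) * Real.log (α / β)) := by
    have : (α : ℝ) - β = 2 * ε := by linarith
    rw [this]
    nlinarith
  rw [sum_bState]
  simp only [banditMDP_P]
  cases s <;> cases a <;> simp only [banditProb, banditRatio, Real.log_one, hlog', h1, h2] <;>
    nlinarith [sq_nonneg ε]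

lemma iUnion_stopAt_disjoint_compl {S A : Type*} [Fintype S] [Fintype A] [MeasurableSpace S]
    [DiscreteMeasurableSpace S] (B : Set (Policy S A)) :
    Disjoint (⋃ n, stopAt B n) (⋃ n, stopAt Bᶜ n) := by
  refine Set.disjoint_left.2 fun ω h h' => ?_
  obtain ⟨m, hm⟩ := Set.mem_iUnion.1 h
  obtain ⟨n, hn⟩ := Set.mem_iUnion.1 h'
  obtain rfl := eq_of_mem_stopAt hm hn
  obtain ⟨-, ψ, hψ, h1⟩ := hm
  obtain ⟨-, θ, hθ, h2⟩ := hn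
  exact hθ (Sum.inl_injective (h1.symm.trans h2) ▸ hψ)

end Bandit

end Imitation

/-! ### The main theorem. -/

open Imitation in
theorem mainTheorem2 :
    ∃ ε₀ δ₀ c : ℝ, 0 < ε₀ ∧ ε₀ ≤ 1 / 2 ∧ 0 < δ₀ ∧ δ₀ ≤ 1 ∧ 0 < c ∧
      ∀ (ε δ γ : ℝ), 0 < ε → ε < ε₀ → 0 < δ → δ < δ₀ → 0 < γ → γ < 1 →
      ∀ (α β : unitInterval), (α : ℝ) = 1 / 2 + ε → (β : ℝ) = 1 / 2 - ε →
      ∀ φ : Policy BState BAction, φ BState.x0 BAction.r = 1 → φ BState.y0 BAction.b = 1 →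
      ∀ alg : Algorithm BState BAction,
        (∀ i : Fin 2,
          ENNReal.ofReal (1 - δ) ≤ interactionLaw ((banditMDP α β).target (alignment i)) alg
            {ω | ∃ ψ, Outputs ω ψ ∧
              imitationLoss (banditMDP α β) γ φ (alignment i) ψ ≤ γ / 4}) →
        ∃ i : Fin 2,
          ENNReal.ofReal (c * (1 / ε ^ 2 * Real.log (1 / δ))) ≤
            ∫⁻ ω, (numTransitions ω : ENNReal)
              ∂(interactionLaw ((banditMDP α β).target (alignment i)) alg) := by
  have hδ₀ : Real.exp (-12) < 1 / 2 := by
    have h := Real.add_one_lt_exp (x := 12) (by norm_num)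
    rw [Real.exp_neg, ← one_div]
    exact one_div_lt_one_div_of_lt (by norm_num) (by linarith)
  -- The bound ε < 1/4 keeps β ≥ 1/4. For δ < exp(-12) the loss of 3 is at most (1/4) log(1/δ),
  -- leaving (1/4) log(1/δ); dividing by 16 ε² gives 1/64.
  refine ⟨1 / 4, Real.exp (-12), 1 / 64, by norm_num, by norm_num, Real.exp_pos _, by linarith,
    by norm_num, ?_⟩
  intro ε δ γ hε hε' hδ hδ' hγ hγ' α β hα hβ φ hφ hφ' alg halg
  refine ⟨0, ?_⟩
  have hφ1 : probX φ = 1 := by rw [probX, hφ, hφ']; norm_num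
  -- The test: the threshold 1/2 separates `probX ≥ 3/4` from `probX ≤ 1/4`.
  set B : Set (Policy BState BAction) := {ψ | 1 / 2 < probX ψ} with hB
  have hBm : MeasurableSet B := measurableSet_lt measurable_const measurable_probX
  have h0 : ENNReal.ofReal (1 - δ) ≤ interactionLaw (banditMDP α β) alg (⋃ n, stopAt B n) := by
    refine (halg 0).trans (measure_mono ?_)
    rw [← exists_outputs_eq_iUnion]
    rintro ω ⟨ψ, hω, hψ⟩
    refine ⟨ψ, hω, ?_⟩
    have := imitationLoss_zero_ge α β hφ1 ψ hγ.le hγ'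
    show 1 / 2 < probX ψ
    nlinarith
  have h1 : ENNReal.ofReal (1 - δ) ≤
      interactionLaw (banditMDP β α) alg (⋃ n, stopAt Bᶜ n) := by
    have h := halg 1
    rw [target_alignment_one] at h
    refine h.trans (measure_mono ?_)
    rw [← exists_outputs_eq_iUnion]
    rintro ω ⟨ψ, hω, hψ⟩
    refine ⟨ψ, hω, ?_⟩
    have := imitationLoss_one_ge α β hφ1 ψ hγ.le hγ'
    show ¬ 1 / 2 < probX ψ
    intro hlt
    nlinarith
  -- A run outputs at most one policy, so outputs in `B` and in `Bᶜ` exclude each other; the latter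
  -- already have probability at least 1 - δ.
  have h1' : interactionLaw (banditMDP β α) alg (⋃ n, stopAt B n) ≤ ENNReal.ofReal δ := by
    have hle : interactionLaw (banditMDP β α) alg (⋃ n, stopAt B n) +
        ENNReal.ofReal (1 - δ) ≤ ENNReal.ofReal δ + ENNReal.ofReal (1 - δ) := by
      rw [← ENNReal.ofReal_add hδ.le (by linarith), add_sub_cancel, ENNReal.ofReal_one]
      refine (add_le_add_right h1 _).trans ?_
      rw [← measure_union (iUnion_stopAt_disjoint_compl B)
        (MeasurableSet.iUnion fun n => measurableSet_stopAt hBm.compl n)]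
      exact prob_le_one
    exact ENNReal.le_of_add_le_add_right ENNReal.ofReal_ne_top hle
  have h0' : 1 / 2 < interactionLaw (banditMDP α β) alg (⋃ n, stopAt B n) := by
    refine lt_of_lt_of_le ?_ h0
    rw [show (1 / 2 : ℝ≥0∞) = ENNReal.ofReal (1 / 2) by
      rw [ENNReal.ofReal_div_of_pos two_pos]; simp]
    exact (ENNReal.ofReal_lt_ofReal_iff (by linarith)).2 (by linarith)
  have hmain := ofReal_le_mul_lintegral_numTransitions
    (isTransitionRatio_banditRatio (by linarith) (by linarith) (by linarith))
    (sum_mul_log_banditRatio_ge hε.le hε'.le hα hβ) (by positivity) hδ (by linarith) alg hBm h0' h1'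
  have hlog : 12 ≤ Real.log (1 / δ) := by
    rw [one_div, Real.log_inv, le_neg]
    exact (Real.log_lt_iff_lt_exp hδ).2 hδ' |>.le
  have hκ : 0 < 16 * ε ^ 2 := by positivity
  rw [target_alignment_zero]
  refine (ENNReal.mul_le_mul_iff_right (ENNReal.ofReal_pos.2 hκ).ne' ENNReal.ofReal_ne_top).1
    (le_trans ?_ hmain)
  rw [← ENNReal.ofReal_mul hκ.le]
  refine ENNReal.ofReal_le_ofReal ?_
  have : 16 * ε ^ 2 * (1 / 64 * (1 / ε ^ 2 * Real.log (1 / δ))) = 1 / 4 * Real.log (1 / δ) := by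
    field_simp
    norm_num
  linarith
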